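/- Anomalous row problem: given a matrix $M\in\mathbb F_2^{k\times m}$ in which one row has exactly $k$ zeroes and every other row has exactly $k+1$ zeroes, find the row with $k$ zeroes. A deterministic algorithm adaptively probes cells of $M$ (each probe may depend on the values seen so far) and finally outputs a row or gives up; a randomized algorithm is a probability distribution over deterministic algorithms. Theorem. Let $(k,m)$ tend to infinity, i.e. $k\to\infty$ and $m\to\infty$ simultaneously, through pairs with $k<m$; this may be the full joint limit over all such pairs or the limit along any sequence of such pairs (more generally, along any proper filter on $\mathbb N\times\mathbb N$ that is finer than the joint limit $k,m\to\infty$ and contains the set $\{k<m\}$). There do not exist a constant $p>0$, a function $q:\mathbb N\times\mathbb N\to\mathbb N$ with $q(k,m)=o(km)$ in this limit, and randomized algorithms $A_{k,m}$ for $k\times m$ matrices, $k,m\in\mathbb N$, such that, for all $(k,m)$ sufficiently far along the limit, on every instance $M\in\mathbb F_2^{k\times m}$ of the anomalous row problem, 1. $A_{k,m}$ probes at most $q(k,m)$ distinct cells of $M$, whatever the outcome of its random choices, and 2. $A_{k,m}$ outputs the row with $k$ zeroes with probability at least $p$. -/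

import Mathlib

open Filter Asymptotics
open scoped ENNReal

namespace AnomalousRow

/-- `IsInstance M r`: the `0/1` matrix `M` is an input of the anomalous row problem whose
anomalous row is `r`: row `r` has exactly `k` zeroes, every other row exactly `k + 1`. -/
def IsInstance {k m : ℕ} (M : Matrix (Fin k) (Fin m) (ZMod 2)) (r : Fin k) : Prop :=
  (Finset.univ.filter fun j => M r j = 0).card = k ∧
    ∀ i, i ≠ r → (Finset.univ.filter fun j => M i j = 0).card = k + 1

/-- A deterministic adaptive algorithm accessing a `k × m` matrix over `𝔽₂` by cell probes:
it either stops with an output (a row, or `none` when it gives up), or probes the cell `(i, j)`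
and continues according to the value found there. -/
inductive ProbeAlgorithm (k m : ℕ) : Type
  | answer (out : Option (Fin k)) : ProbeAlgorithm k m
  | probe (i : Fin k) (j : Fin m) (next : ZMod 2 → ProbeAlgorithm k m) : ProbeAlgorithm k m

namespace ProbeAlgorithm

/-- The output of the algorithm on the input matrix `M`. -/
def output {k m : ℕ} (M : Matrix (Fin k) (Fin m) (ZMod 2)) :
    ProbeAlgorithm k m → Option (Fin k)
  | answer out => out
  | probe i j next => output M (next (M i j))

/-- The set of cells probed by the algorithm on the input matrix `M`. -/
def probedCells {k m : ℕ} (M : Matrix (Fin k) (Fin m) (ZMod 2)) :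
    ProbeAlgorithm k m → Finset (Fin k × Fin m)
  | answer _ => ∅
  | probe i j next => insert (i, j) (probedCells M (next (M i j)))

end ProbeAlgorithm

/-- A randomized (Monte Carlo) algorithm: a probability distribution over deterministic
algorithms. There are only countably many of the latter, so a `PMF` is fully general. -/
abbrev RandomizedAlgorithm (k m : ℕ) : Type := PMF (ProbeAlgorithm k m)

namespace RandomizedAlgorithm

/-- On every input of the problem and for every outcome of the coin tosses, the randomized
algorithm probes at most `q` distinct cells. -/
def ProbesAtMost {k m : ℕ} (A : RandomizedAlgorithm k m) (q : ℕ) : Prop :=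
  ∀ (M : Matrix (Fin k) (Fin m) (ZMod 2)) (r : Fin k), IsInstance M r →
    ∀ D ∈ A.support, (D.probedCells M).card ≤ q

/-- The probability, over the coin tosses, that the algorithm outputs row `r` on input `M`. -/
noncomputable def outputProb {k m : ℕ} (A : RandomizedAlgorithm k m)
    (M : Matrix (Fin k) (Fin m) (ZMod 2)) (r : Fin k) : ℝ≥0∞ :=
  (A.map fun D => D.output M) (some r)

/-- On every input of the problem, the algorithm outputs the anomalous row with probability
at least `p`. -/
def SolvesWithProb {k m : ℕ} (A : RandomizedAlgorithm k m) (p : ℝ≥0∞) : Prop :=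
  ∀ (M : Matrix (Fin k) (Fin m) (ZMod 2)) (r : Fin k), IsInstance M r → p ≤ A.outputProb M r

end RandomizedAlgorithm

end AnomalousRow

namespace AnomalousRow

open ProbeAlgorithm

/-! Take a uniformly random matrix `N` with `k + 1` zeroes in every row and turn a uniformly random
zero `c` of it into a one: this is an instance whose anomalous row is `c.1`. Unless the algorithm
meets `c`, it answers as on `N`, and that answer is right for at most `k + 1` of the `k (k + 1)`
zeroes. On `N` itself, `q` probes find on average at most `2 (k + 1) q / m` zeroes
(`sum_card_probed_zeros_le`, by a supermartingale). So the success probability is at most `1 / k + 2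
q / (k m)`, which tends to `0` when `q = o(k m)`. Averaging over the coin tosses extends the bound
to randomized algorithms. -/

/-! ### Exchangeability of the unprobed cells of a row -/

/-- Exchange the entries in columns `j` and `j'` of row `i`. -/
def swapInRow {k m : ℕ} (N : Matrix (Fin k) (Fin m) (ZMod 2)) (i : Fin k) (j j' : Fin m) :
    Matrix (Fin k) (Fin m) (ZMod 2) :=
  fun a b => if a = i then N a (Equiv.swap j j' b) else N a b

/-- The family `Ω` is closed under exchanging two cells of a row that both lie outside `S`. -/
def SwapClosed {k m : ℕ} (S : Finset (Fin k × Fin m))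
    (Ω : Finset (Matrix (Fin k) (Fin m) (ZMod 2))) : Prop :=
  ∀ N ∈ Ω, ∀ i j j', (i, j) ∉ S → (i, j') ∉ S → swapInRow N i j j' ∈ Ω

lemma swapInRow_swapInRow {k m : ℕ} (N : Matrix (Fin k) (Fin m) (ZMod 2)) (i : Fin k)
    (j j' : Fin m) : swapInRow (swapInRow N i j j') i j j' = N := by
  funext a b
  by_cases h : a = i <;> simp [swapInRow, h]

/-- Exchangeability of the unprobed cells survives conditioning on the result of a probe, so it
persists along an adaptive run. -/
lemma SwapClosed.filter_insert {k m : ℕ} {S : Finset (Fin k × Fin m)}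
    {Ω : Finset (Matrix (Fin k) (Fin m) (ZMod 2))} (h : SwapClosed S Ω) (i : Fin k) (j : Fin m)
    (v : ZMod 2) : SwapClosed (insert (i, j) S) (Ω.filter fun N => N i j = v) := by
  intro N hN a b b' hb hb'
  simp only [Finset.mem_insert, not_or, Prod.mk.injEq, Finset.mem_filter] at hN hb hb' ⊢
  refine ⟨h N hN.1 a b b' hb.2 hb'.2, ?_⟩
  by_cases ha : i = a
  · subst ha
    have h1 : j ≠ b := fun e => hb.1 ⟨rfl, e.symm⟩
    have h2 : j ≠ b' := fun e => hb'.1 ⟨rfl, e.symm⟩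
    simp [swapInRow, Equiv.swap_apply_of_ne_of_ne h1 h2, hN.2]
  · simp [swapInRow, ha, hN.2]

/-- The zeroes of `N` in row `i` among the cells of `S`. -/
def zerosIn {k m : ℕ} (S : Finset (Fin k × Fin m)) (N : Matrix (Fin k) (Fin m) (ZMod 2))
    (i : Fin k) : Finset (Fin m) :=
  Finset.univ.filter fun j => (i, j) ∈ S ∧ N i j = 0

/-- The columns of the cells of `S` in row `i`. -/
def rowOf {k m : ℕ} (S : Finset (Fin k × Fin m)) (i : Fin k) : Finset (Fin m) :=
  Finset.univ.filter fun j => (i, j) ∈ S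

/-- An unprobed cell is zero in at most the average proportion of a swap-closed family. -/
lemma SwapClosed.card_zero_mul_le {k m K : ℕ} {S : Finset (Fin k × Fin m)}
    {Ω : Finset (Matrix (Fin k) (Fin m) (ZMod 2))} (h : SwapClosed S Ω)
    (hK : ∀ N ∈ Ω, ∀ i, (Finset.univ.filter fun j => N i j = 0).card ≤ K)
    {i : Fin k} {j : Fin m} (hij : (i, j) ∉ S) :
    (m - (rowOf S i).card) * (Ω.filter fun N => N i j = 0).card ≤ K * Ω.card := by
  have hcompl : ((rowOf S i)ᶜ).card = m - (rowOf S i).card := by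
    rw [Finset.card_compl, Fintype.card_fin]
  have hle : ∀ j' ∈ (rowOf S i)ᶜ,
      (Ω.filter fun N => N i j = 0).card ≤ (Ω.filter fun N => N i j' = 0).card := by
    intro j' hj'
    have hj' : (i, j') ∉ S := by simpa [rowOf] using hj'
    -- Exchanging `j` and `j'` is an involution, hence injective.
    refine Finset.card_le_card_of_injOn (fun N => swapInRow N i j j') ?_ ?_
    · intro N hN
      simp only [Finset.coe_filter, Set.mem_ofPred_eq] at hN ⊢
      exact ⟨h N hN.1 i j j' hij hj', by simp [swapInRow, hN.2]⟩
    · intro N _ N' _ e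
      have e := congrArg (fun X => swapInRow X i j j') e
      simpa only [swapInRow_swapInRow] using e
  calc (m - (rowOf S i).card) * (Ω.filter fun N => N i j = 0).card
      ≤ ∑ j' ∈ (rowOf S i)ᶜ, (Ω.filter fun N => N i j' = 0).card := by
        rw [← hcompl, ← smul_eq_mul]
        exact Finset.card_nsmul_le_sum _ _ _ hle
    _ = ∑ N ∈ Ω, ((rowOf S i)ᶜ.filter fun j' => N i j' = 0).card := by
        simp only [Finset.card_filter]
        exact Finset.sum_comm
    _ ≤ ∑ _N ∈ Ω, K := Finset.sum_le_sum fun N hN =>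
        (Finset.card_le_card (Finset.filter_subset_filter _ (Finset.subset_univ _))).trans
          (hK N hN i)
    _ = K * Ω.card := by rw [Finset.sum_const, smul_eq_mul, mul_comm]

/-! ### The potential as a supermartingale -/

/-- Potential of a set `S` of probed cells: a row with `s` probed cells, `z` of them zero,
contributes `z (m - s) - K s`. -/
def potential {k m : ℕ} (K : ℕ) (S : Finset (Fin k × Fin m))
    (N : Matrix (Fin k) (Fin m) (ZMod 2)) : ℤ :=
  ∑ i, (((zerosIn S N i).card : ℤ) * ((m : ℤ) - (rowOf S i).card) - K * (rowOf S i).card)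

lemma card_rowOf_le {k m : ℕ} (S : Finset (Fin k × Fin m)) (i : Fin k) :
    (rowOf S i).card ≤ m := by
  simpa using Finset.card_le_univ (rowOf S i)

lemma rowOf_insert_self {k m : ℕ} (S : Finset (Fin k × Fin m)) (i : Fin k) (j : Fin m) :
    rowOf (insert (i, j) S) i = insert j (rowOf S i) := by
  ext b; simp [rowOf]

lemma rowOf_insert_of_ne {k m : ℕ} (S : Finset (Fin k × Fin m)) {i a : Fin k} (h : a ≠ i)
    (j : Fin m) : rowOf (insert (i, j) S) a = rowOf S a := by
  ext b; simp [rowOf, h]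

lemma zerosIn_insert_of_ne {k m : ℕ} (S : Finset (Fin k × Fin m))
    (N : Matrix (Fin k) (Fin m) (ZMod 2)) {i a : Fin k} (h : a ≠ i) (j : Fin m) :
    zerosIn (insert (i, j) S) N a = zerosIn S N a := by
  ext b; simp [zerosIn, h]

lemma card_zerosIn_insert_self {k m : ℕ} {S : Finset (Fin k × Fin m)}
    (N : Matrix (Fin k) (Fin m) (ZMod 2)) {i : Fin k} {j : Fin m} (hij : (i, j) ∉ S) :
    (zerosIn (insert (i, j) S) N i).card
      = (zerosIn S N i).card + if N i j = 0 then 1 else 0 := by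
  split_ifs with h0
  · rw [← Finset.card_insert_of_notMem (a := j) (s := zerosIn S N i) (by simp [zerosIn, hij])]
    congr 1
    ext b
    simp only [zerosIn, Finset.mem_filter, Finset.mem_univ, Finset.mem_insert, Prod.mk.injEq]
    grind
  · rw [add_zero]
    congr 1
    ext b
    simp only [zerosIn, Finset.mem_filter, Finset.mem_univ, Finset.mem_insert, Prod.mk.injEq]
    grind

/-- If `δ` is 1 when the new cell is zero and 0 otherwise, the exact increment is `δ (m - s - 1) - z
- K`; the terms `-δ` and `-z` are dropped. -/
lemma potential_insert_le {k m : ℕ} (K : ℕ) {S : Finset (Fin k × Fin m)}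
    (N : Matrix (Fin k) (Fin m) (ZMod 2)) {i : Fin k} {j : Fin m} (hij : (i, j) ∉ S) :
    potential K (insert (i, j) S) N ≤ potential K S N
      + ((if N i j = 0 then 1 else 0) * ((m : ℤ) - (rowOf S i).card) - K) := by
  unfold potential
  rw [← Finset.add_sum_erase _ _ (Finset.mem_univ i),
    ← Finset.add_sum_erase (a := i) Finset.univ (fun i => ((zerosIn S N i).card : ℤ) *
      ((m : ℤ) - (rowOf S i).card) - K * (rowOf S i).card) (Finset.mem_univ i)]
  rw [Finset.sum_congr rfl fun a ha => by
    rw [rowOf_insert_of_ne S (Finset.ne_of_mem_erase ha),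
      zerosIn_insert_of_ne S N (Finset.ne_of_mem_erase ha)]]
  rw [card_zerosIn_insert_self N hij, rowOf_insert_self,
    Finset.card_insert_of_notMem (by simpa [rowOf] using hij)]
  push_cast
  have hz : (0 : ℤ) ≤ (zerosIn S N i).card := by positivity
  split_ifs <;> nlinarith

lemma SwapClosed.sum_potential_insert_le {k m K : ℕ} {S : Finset (Fin k × Fin m)}
    {Ω : Finset (Matrix (Fin k) (Fin m) (ZMod 2))} (h : SwapClosed S Ω)
    (hK : ∀ N ∈ Ω, ∀ i, (Finset.univ.filter fun j => N i j = 0).card ≤ K)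
    (i : Fin k) (j : Fin m) :
    ∑ N ∈ Ω, potential K (insert (i, j) S) N ≤ ∑ N ∈ Ω, potential K S N := by
  by_cases hij : (i, j) ∈ S
  · rw [Finset.insert_eq_of_mem hij]
  refine (Finset.sum_le_sum fun N _ => potential_insert_le K N hij).trans ?_
  rw [Finset.sum_add_distrib, Finset.sum_sub_distrib, ← Finset.sum_mul, Finset.sum_boole,
    Finset.sum_const, nsmul_eq_mul]
  -- The new cell is zero with frequency at most `K / (m - s)`, so the mean increment is at most
  -- `0`.
  have key := h.card_zero_mul_le hK hij
  zify [card_rowOf_le S i] at key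
  linarith

/-- The potential does not increase on average along a run of a probe algorithm. -/
lemma SwapClosed.sum_potential_le {k m K : ℕ} (D : ProbeAlgorithm k m)
    {S : Finset (Fin k × Fin m)} {Ω : Finset (Matrix (Fin k) (Fin m) (ZMod 2))}
    (h : SwapClosed S Ω)
    (hK : ∀ N ∈ Ω, ∀ i, (Finset.univ.filter fun j => N i j = 0).card ≤ K) :
    ∑ N ∈ Ω, potential K (S ∪ D.probedCells N) N ≤ ∑ N ∈ Ω, potential K S N := by
  induction D generalizing S Ω with
  | answer o => simp [probedCells]
  | probe i j next ih =>
    refine le_trans ?_ (h.sum_potential_insert_le hK i j)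
    -- On each fibre of the probed value the algorithm continues as one fixed subtree, and the fibre
    -- is again swap-closed.
    rw [← Finset.sum_fiberwise Ω (fun N => N i j),
      ← Finset.sum_fiberwise Ω (fun N => N i j) (fun N => potential K (insert (i, j) S) N)]
    refine Finset.sum_le_sum fun v _ => ?_
    refine le_trans (le_of_eq ?_) (ih v (h.filter_insert i j v)
      fun N hN => hK N (Finset.mem_filter.1 hN).1)
    refine Finset.sum_congr rfl fun N hN => ?_
    have hv : N i j = v := (Finset.mem_filter.1 hN).2
    simp [probedCells, hv, Finset.union_insert, Finset.insert_union]

lemma sum_card_rowOf {k m : ℕ} (S : Finset (Fin k × Fin m)) :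
    ∑ i, (rowOf S i).card = S.card := by
  have : S.card = (Finset.univ.filter fun c => c ∈ S).card := by simp
  rw [this]
  simp only [rowOf, Finset.card_filter]
  rw [Fintype.sum_prod_type]

lemma sum_card_zerosIn {k m : ℕ} (S : Finset (Fin k × Fin m))
    (N : Matrix (Fin k) (Fin m) (ZMod 2)) :
    ∑ i, (zerosIn S N i).card = (S.filter fun c => N c.1 c.2 = 0).card := by
  have : S.filter (fun c => N c.1 c.2 = 0)
      = Finset.univ.filter fun c => c ∈ S ∧ N c.1 c.2 = 0 := by ext; simp
  rw [this]
  simp only [zerosIn, Finset.card_filter]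
  rw [Fintype.sum_prod_type]

/-- In each row `m z` exceeds the potential by `z s + K s`, and `z ≤ K`. -/
lemma card_zeros_mul_le_potential {k m K : ℕ} (S : Finset (Fin k × Fin m))
    {N : Matrix (Fin k) (Fin m) (ZMod 2)}
    (hK : ∀ i, (Finset.univ.filter fun j => N i j = 0).card ≤ K) :
    (m : ℤ) * (S.filter fun c => N c.1 c.2 = 0).card ≤ potential K S N + 2 * K * S.card := by
  rw [← sum_card_zerosIn, ← sum_card_rowOf, potential]
  push_cast
  rw [Finset.mul_sum, Finset.mul_sum, ← Finset.sum_add_distrib]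
  refine Finset.sum_le_sum fun i _ => ?_
  have hz : ((zerosIn S N i).card : ℤ) ≤ K := by
    refine Nat.cast_le.2 (le_trans (Finset.card_le_card ?_) (hK i))
    intro b hb
    simp only [zerosIn, Finset.mem_filter] at hb ⊢
    exact ⟨hb.1, hb.2.2⟩
  have := mul_le_mul_of_nonneg_right hz (Nat.cast_nonneg (α := ℤ) (rowOf S i).card)
  linarith

/-- On average over a swap-closed family with at most `K` zeroes per row, `q` probes find at most
`2 K q / m` zeroes. -/
lemma sum_card_probed_zeros_le {k m K q : ℕ} (D : ProbeAlgorithm k m)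
    {Ω : Finset (Matrix (Fin k) (Fin m) (ZMod 2))} (h : SwapClosed ∅ Ω)
    (hK : ∀ N ∈ Ω, ∀ i, (Finset.univ.filter fun j => N i j = 0).card ≤ K)
    (hq : ∀ N ∈ Ω, (D.probedCells N).card ≤ q) :
    m * ∑ N ∈ Ω, ((D.probedCells N).filter fun c => N c.1 c.2 = 0).card
      ≤ 2 * K * q * Ω.card := by
  have h1 := h.sum_potential_le D hK
  have h0 : ∀ N, potential K (∅ : Finset (Fin k × Fin m)) N = 0 := by
    intro N; simp [potential, zerosIn, rowOf]
  simp only [h0, Finset.sum_const_zero, Finset.empty_union] at h1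
  zify
  rw [Finset.mul_sum]
  calc ∑ N ∈ Ω, (m : ℤ) * ((D.probedCells N).filter fun c => N c.1 c.2 = 0).card
      ≤ ∑ N ∈ Ω, (potential K (D.probedCells N) N + 2 * K * q) := by
        refine Finset.sum_le_sum fun N hN =>
          (card_zeros_mul_le_potential _ (hK N hN)).trans ?_
        have := hq N hN
        gcongr
    _ ≤ 2 * K * q * Ω.card := by
        rw [Finset.sum_add_distrib, Finset.sum_const, nsmul_eq_mul]
        linarith

/-! ### Truncation to the probe budget -/

namespace ProbeAlgorithm

/-- Give up before the set of probed cells, including those of `S`, exceeds size `q`. -/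
def truncate {k m : ℕ} (q : ℕ) : Finset (Fin k × Fin m) → ProbeAlgorithm k m → ProbeAlgorithm k m
  | _, answer o => answer o
  | S, probe i j next =>
    if (insert (i, j) S).card ≤ q then
      probe i j fun v => truncate q (insert (i, j) S) (next v)
    else answer none

lemma card_probedCells_truncate_le {k m q : ℕ} (N : Matrix (Fin k) (Fin m) (ZMod 2))
    (D : ProbeAlgorithm k m) (S : Finset (Fin k × Fin m)) (hS : S.card ≤ q) :
    (S ∪ (D.truncate q S).probedCells N).card ≤ q := by
  induction D generalizing S with
  | answer o => simpa [truncate, probedCells]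
  | probe i j next ih =>
    rw [truncate]
    split_ifs with h
    · simpa [probedCells, Finset.union_insert, Finset.insert_union] using ih (N i j) _ h
    · simpa [probedCells]

/-- The budget is promised on instances only, and null matrices are not instances. Truncation
enforces it everywhere without changing the answer on instances. -/
lemma output_truncate {k m q : ℕ} (N : Matrix (Fin k) (Fin m) (ZMod 2))
    (D : ProbeAlgorithm k m) (S : Finset (Fin k × Fin m))
    (hS : (S ∪ D.probedCells N).card ≤ q) :
    (D.truncate q S).output N = D.output N := by
  induction D generalizing S with
  | answer o => rfl
  | probe i j next ih =>
    have hS' : (insert (i, j) S ∪ (next (N i j)).probedCells N).card ≤ q := by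
      simpa [probedCells, Finset.union_insert, Finset.insert_union] using hS
    rw [truncate, if_pos ((Finset.card_le_card Finset.subset_union_left).trans hS')]
    exact ih _ _ hS'

lemma output_congr {k m : ℕ} {M N : Matrix (Fin k) (Fin m) (ZMod 2)} (D : ProbeAlgorithm k m)
    (h : ∀ c ∈ D.probedCells N, M c.1 c.2 = N c.1 c.2) : D.output M = D.output N := by
  induction D with
  | answer o => rfl
  | probe i j next ih =>
    simp only [probedCells, Finset.mem_insert, forall_eq_or_imp] at h
    rw [output, output, h.1]
    exact ih _ h.2

end ProbeAlgorithm

/-! ### Planting the anomaly in a null matrix -/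

/-- The matrices with exactly `k + 1` zeroes in every row. -/
def nullMatrices (k m : ℕ) : Finset (Matrix (Fin k) (Fin m) (ZMod 2)) :=
  Finset.univ.filter fun N => ∀ i, (Finset.univ.filter fun j => N i j = 0).card = k + 1

/-- The cells holding a zero. -/
def zeroCells {k m : ℕ} (N : Matrix (Fin k) (Fin m) (ZMod 2)) : Finset (Fin k × Fin m) :=
  Finset.univ.filter fun c => N c.1 c.2 = 0

/-- The matrix `N` with a one written into the cell `c`. -/
def setOne {k m : ℕ} (N : Matrix (Fin k) (Fin m) (ZMod 2)) (c : Fin k × Fin m) :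
    Matrix (Fin k) (Fin m) (ZMod 2) :=
  fun a b => if (a, b) = c then 1 else N a b

lemma swapClosed_nullMatrices (k m : ℕ) : SwapClosed ∅ (nullMatrices k m) := by
  intro N hN i j j' _ _
  simp only [nullMatrices, Finset.mem_filter, Finset.mem_univ, true_and] at hN ⊢
  intro a
  rw [← hN a]
  by_cases h : a = i
  · refine Finset.card_equiv (Equiv.swap j j') fun b => ?_
    simp [swapInRow, h]
  · simp [swapInRow, h]

lemma nullMatrices_nonempty {k m : ℕ} (h : k < m) : (nullMatrices k m).Nonempty := by
  obtain ⟨s, -, hs⟩ := Finset.exists_subset_card_eq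
    (s := (Finset.univ : Finset (Fin m))) (n := k + 1) (by simpa using h)
  refine ⟨fun _ b => if b ∈ s then 0 else 1, ?_⟩
  refine Finset.mem_filter.2 ⟨Finset.mem_univ _, fun i => ?_⟩
  simp [hs]

lemma isInstance_setOne {k m : ℕ} {N : Matrix (Fin k) (Fin m) (ZMod 2)}
    (hN : N ∈ nullMatrices k m) {c : Fin k × Fin m} (hc : c ∈ zeroCells N) :
    IsInstance (setOne N c) c.1 := by
  obtain ⟨r, j⟩ := c
  simp only [nullMatrices, zeroCells, Finset.mem_filter, Finset.mem_univ, true_and] at hN hc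
  refine ⟨?_, fun i hi => ?_⟩
  · have : (Finset.univ.filter fun b => setOne N (r, j) r b = 0)
        = (Finset.univ.filter fun b => N r b = 0).erase j := by
      ext b
      by_cases hb : b = j <;> simp [setOne, hb]
    rw [this, Finset.card_erase_of_mem (by simpa using hc), hN r, Nat.add_sub_cancel]
  · rw [← hN i]
    simp [setOne, hi]

lemma card_zeroCells {k m : ℕ} {N : Matrix (Fin k) (Fin m) (ZMod 2)}
    (hN : N ∈ nullMatrices k m) : (zeroCells N).card = k * (k + 1) := by
  simp only [nullMatrices, Finset.mem_filter, Finset.mem_univ, true_and] at hN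
  simp only [zeroCells, Finset.card_filter] at hN ⊢
  rw [Fintype.sum_prod_type]
  simp [hN]

lemma card_zeroCells_output_le {k m : ℕ} {N : Matrix (Fin k) (Fin m) (ZMod 2)}
    (hN : N ∈ nullMatrices k m) (o : Option (Fin k)) :
    ((zeroCells N).filter fun c => some c.1 = o).card ≤ k + 1 := by
  cases o with
  | none => simp
  | some r =>
    simp only [nullMatrices, Finset.mem_filter, Finset.mem_univ, true_and] at hN
    rw [← hN r]
    refine Finset.card_le_card_of_injOn Prod.snd ?_ ?_
    · rintro ⟨a, b⟩ hc
      simp only [zeroCells, Finset.coe_filter, Set.mem_ofPred_eq, Finset.mem_filter,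
        Option.some.injEq] at hc ⊢
      exact ⟨Finset.mem_univ _, hc.2 ▸ hc.1.2⟩
    · rintro ⟨a, b⟩ hc ⟨a', b'⟩ hc' e
      simp only [Finset.coe_filter, Set.mem_ofPred_eq, Option.some.injEq] at hc hc'
      exact Prod.ext (hc.2.trans hc'.2.symm) e

/-- The number of choices of a null matrix and of a zero of it for which a deterministic algorithm
with `q` probes locates the row of this zero after it has been turned into a one. -/
lemma sum_card_success_le {k m q : ℕ} (D : ProbeAlgorithm k m)
    (hq : ∀ M r, IsInstance M r → (D.probedCells M).card ≤ q) :
    m * ∑ N ∈ nullMatrices k m,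
        ((zeroCells N).filter fun c => some c.1 = D.output (setOne N c)).card
      ≤ (k + 1) * (m + 2 * q) * (nullMatrices k m).card := by
  set T := D.truncate q ∅ with hT
  have hTq : ∀ N, (T.probedCells N).card ≤ q := fun N => by
    simpa using card_probedCells_truncate_le N D ∅ (by simp)
  have hK : ∀ N ∈ nullMatrices k m, ∀ i,
      (Finset.univ.filter fun j => N i j = 0).card ≤ k + 1 := fun N hN i => by
    simp only [nullMatrices, Finset.mem_filter] at hN
    exact (hN.2 i).le
  have hprobe := sum_card_probed_zeros_le (q := q) T (swapClosed_nullMatrices k m) hK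
    fun N _ => hTq N
  have hterm : ∀ N ∈ nullMatrices k m,
      ((zeroCells N).filter fun c => some c.1 = D.output (setOne N c)).card
        ≤ (k + 1) + ((T.probedCells N).filter fun c => N c.1 c.2 = 0).card := by
    intro N hN
    refine le_trans ?_ (Nat.add_le_add_right (card_zeroCells_output_le hN (T.output N)) _)
    refine le_trans (Finset.card_le_card ?_) (Finset.card_union_le _ _)
    intro c hc
    simp only [Finset.mem_filter, Finset.mem_union] at hc ⊢
    have h0 : N c.1 c.2 = 0 := by simpa [zeroCells] using hc.1
    -- Either the planted cell is among the probed zeroes, or `T` cannot tell `setOne N c` from `N`.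
    by_cases hcT : c ∈ T.probedCells N
    · exact Or.inr ⟨hcT, h0⟩
    refine Or.inl ⟨hc.1, ?_⟩
    rw [hc.2, ← output_truncate (q := q) (setOne N c) D ∅
      (by simpa using hq _ _ (isInstance_setOne hN hc.1))]
    refine output_congr T fun d hd => ?_
    have hdc : d ≠ c := fun e => hcT (e ▸ hd)
    simp [setOne, hdc]
  have hsum := Nat.mul_le_mul_left m (Finset.sum_le_sum hterm)
  rw [Finset.sum_add_distrib, Finset.sum_const, smul_eq_mul] at hsum
  nlinarith

/-! ### Randomized algorithms and the limit -/

lemma RandomizedAlgorithm.mul_le_of_solvesWithProb {k m q : ℕ} {p : ℝ≥0∞} (hk : k < m)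
    (A : RandomizedAlgorithm k m) (hq : A.ProbesAtMost q) (hp : A.SolvesWithProb p) :
    p * (k * m : ℕ) ≤ (m + 2 * q : ℕ) := by
  -- There are `k * B` pairs of a null matrix and a zero of it; `B` cancels at the end.
  set B : ℕ := (k + 1) * (nullMatrices k m).card with hB
  have hB0 : (B : ℝ≥0∞) ≠ 0 := by
    have := Finset.card_pos.2 (nullMatrices_nonempty hk)
    exact Nat.cast_ne_zero.2 (by positivity)
  have hprob : ∀ M r, A.outputProb M r
      = ∑' D, A D * (if some r = D.output M then 1 else 0) := by
    intro M r
    simp only [RandomizedAlgorithm.outputProb, PMF.map_apply, mul_ite, mul_one, mul_zero]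
    exact tsum_congr fun D => by split_ifs <;> rfl
  have hlow : p * (k * B : ℕ) ≤ ∑ N ∈ nullMatrices k m, ∑ c ∈ zeroCells N,
      A.outputProb (setOne N c) c.1 := by
    calc p * (k * B : ℕ)
        = ∑ N ∈ nullMatrices k m, ∑ _c ∈ zeroCells N, p := by
          rw [Finset.sum_congr rfl fun N hN => by rw [Finset.sum_const, card_zeroCells hN],
            Finset.sum_const, hB]
          simp only [nsmul_eq_mul]
          push_cast
          ring
      _ ≤ _ := Finset.sum_le_sum fun N hN => Finset.sum_le_sum fun c hc =>
          hp _ _ (isInstance_setOne hN hc)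
  have hup : (m : ℝ≥0∞) * ∑ N ∈ nullMatrices k m, ∑ c ∈ zeroCells N,
      A.outputProb (setOne N c) c.1 ≤ ((m + 2 * q) * B : ℕ) := by
    simp only [hprob]
    rw [Finset.sum_congr rfl fun N _ =>
      (Summable.tsum_finsetSum fun c _ => ENNReal.summable).symm,
      ← Summable.tsum_finsetSum fun N _ => ENNReal.summable, ← ENNReal.tsum_mul_left]
    calc _ ≤ ∑' D, A D * ((m + 2 * q) * B : ℕ) := by
          refine ENNReal.tsum_le_tsum fun D => ?_
          by_cases hD : A D = 0
          · simp [hD]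
          have hs := sum_card_success_le D fun M r h =>
            hq M r h D ((PMF.mem_support_iff _ _).2 hD)
          simp only [← Finset.mul_sum, Finset.sum_boole]
          rw [mul_left_comm]
          gcongr
          rw [← Nat.cast_sum, ← Nat.cast_mul, hB]
          refine Nat.cast_le.2 (hs.trans (le_of_eq (by ring)))
      _ = _ := by rw [ENNReal.tsum_mul_right, A.tsum_coe, one_mul]
  refine (ENNReal.mul_le_mul_iff_left hB0 (ENNReal.natCast_ne_top B)).1 ?_
  calc p * (k * m : ℕ) * B = m * (p * (k * B : ℕ)) := by push_cast; ring
    _ ≤ ((m + 2 * q) * B : ℕ) := le_trans (by gcongr) hup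
    _ = _ := by push_cast; ring

end AnomalousRow

/-- The filter `l` describes the way in which `(k, m)` tends to infinity, through sizes with `k < m`
(for which inputs of the problem exist). It may be the full joint limit `k, m → ∞` over all such
pairs, or the limit along any sequence of such pairs. -/
theorem mainTheorem2 (l : Filter (ℕ × ℕ)) [l.NeBot]
    (hl : l ≤ atTop ×ˢ atTop) (hlt : ∀ᶠ x in l, x.1 < x.2) :
    ¬ ∃ (A : ∀ k m : ℕ, AnomalousRow.RandomizedAlgorithm k m) (q : ℕ → ℕ → ℕ) (p : ℝ≥0∞),
      0 < p ∧
      (fun x : ℕ × ℕ => (q x.1 x.2 : ℝ)) =o[l] (fun x : ℕ × ℕ => (x.1 : ℝ) * (x.2 : ℝ)) ∧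
      (∀ᶠ x in l, (A x.1 x.2).ProbesAtMost (q x.1 x.2)) ∧
      (∀ᶠ x in l, (A x.1 x.2).SolvesWithProb p) := by
  rintro ⟨A, q, p, hp, hq, hprobes, hsolves⟩
  -- Capping at 1 excludes `p = ⊤`, whose `toReal` is 0.
  set e : ℝ := (min p 1).toReal with he
  have hne : min p 1 ≠ ⊤ := ne_top_of_le_ne_top ENNReal.one_ne_top (min_le_right _ _)
  have he0 : 0 < e := ENNReal.toReal_pos (lt_min hp one_pos).ne' hne
  have hk : ∀ᶠ x : ℕ × ℕ in l, 2 / e ≤ x.1 := by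
    have h1 : Tendsto (fun x : ℕ × ℕ => (x.1 : ℝ)) l atTop :=
      tendsto_natCast_atTop_atTop.comp (tendsto_fst.mono_left hl)
    exact h1.eventually_ge_atTop _
  have hqe := hq.bound (show 0 < e / 8 by positivity)
  obtain ⟨⟨k, m⟩, hkm, hp1, hp2, hk, hqe⟩ :=
    (hlt.and (hprobes.and (hsolves.and (hk.and hqe)))).exists
  dsimp only at hkm hp1 hp2 hk hqe
  have hmain : min p 1 * (k * m : ℕ) ≤ (m + 2 * q k m : ℕ) :=
    le_trans (by gcongr; exact min_le_left _ _)
      ((A k m).mul_le_of_solvesWithProb hkm hp1 hp2)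
  have hreal := ENNReal.toReal_mono (ENNReal.natCast_ne_top _) hmain
  rw [ENNReal.toReal_mul, ENNReal.toReal_natCast, ENNReal.toReal_natCast, ← he] at hreal
  push_cast at hreal
  rw [Real.norm_of_nonneg (by positivity), Real.norm_of_nonneg (by positivity)] at hqe
  have hm : (0 : ℝ) < m := by exact_mod_cast (Nat.zero_le k).trans_lt hkm
  have hke : 2 ≤ e * k := by rwa [div_le_iff₀ he0, mul_comm] at hk
  -- Here `m ≤ e k m / 2` and `2 q ≤ e k m / 4`, against `e k m ≤ m + 2 q`.
  nlinarith
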